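/- Let $m,r,\gamma>0$ and $g\in\mathbb R$, and let $e\in\mathbb R^3$ be a unit vector. Let $\mathcal B\subset\mathbb R^3$ be a solid cylinder with axis vector $e$ (that is, $a+se\in\mathcal B$ for all $a\in\mathcal B$, $s\in\mathbb R$) whose boundary $S=\partial\mathcal B$ is a smooth surface with $\mathcal B$ locally on one side of it. Let $\nu$ be the unit normal field of $S$ pointing into $\mathcal B$, let $\mathbb S_a v=-D_v\nu$ be the shape operator of $S$ at $a$, put $\tau=\nu\times e$ and $\lambda(a)=\mathbb S_a\tau_a\cdot\tau_a$. On $SO(3)\times S$ consider the kinetic energy metric of a ball of radius $r$, mass $m$ and mass distribution parameter $\gamma$ (its matrix of second moments per unit mass is $\tfrac12(r\gamma)^2 I$): for tangent vectors at $(A,a)$ written as $(UA,u)$, $(VA,v)$ with $U,V\in\mathfrak{so}(3)$ and $u,v\in T_aS$, $$\langle (UA,u),(VA,v)\rangle=m\left\{\tfrac{(r\gamma)^2}{2}\operatorname{Tr}(UV^{\dagger})+u\cdot v\right\},$$ and let $\nabla$ be its Levi-Civita connection. Let $\mathfrak S_{(A,a)}=\{(UA,u): U\in\mathfrak{so}(3),\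 u=rU\nu_a\}$ be the no-slip space, and $\mathfrak S^\perp_{(A,a)}$ its orthogonal complement in $T_{(A,a)}(SO(3)\times S)$. Let $I$ be an open interval containing $0$ and let $q=(A,a):I\to SO(3)\times S$ be a smooth path that describes rolling without slipping under the constant force $-mge$ acting on the center of mass, i.e. for all $t\in I$ $$\dot q(t)\in\mathfrak S_{q(t)},\qquad \frac{\nabla\dot q}{dt}=(0,-ge)+N(t)\quad\text{for some } N(t)\in\mathfrak S^\perp_{q(t)}.$$ Write $u=\dot a$, $U=\dot AA^{-1}$, let the angular velocity vector $\omega(t)$ be defined by $\omega\times w=Uw$ for all $w\in\mathbb R^3$, and let $h=a\cdot e$ be the height of the center of mass. Write $\omega_e=\omega\cdot e$ and $\omega_\nu=\omega\cdot\nu_{a}$. Then $\mathbb S_a\tau_a=\lambda(a)\tau_a$ and $\mathbb S_ae=0$ for all $a\in S$ (so that $\lambda(a)$ is the principal curvature in direction $\tau_a$); $\omega\cdot e$ is constant in $t$; and for all $t\in I$ $$\frac{d}{dt}(u\cdot e)+\frac{\gamma^2}{1+\gamma^2}\,r^2\lambda(a)(\omega\cdot e)(\omega\cdot\nu)+\frac{g}{1+\gamma^2}=0,\qquad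 \frac{d}{dt}(\omega\cdot\nu)=\lambda(a)(\omega\cdot e)(u\cdot e).$$ Moreover $u\cdot e=\dot h$, and $$\ddot h+\frac{\gamma^2}{1+\gamma^2}\,r^2\lambda(a)\,\omega_e(0)\left[\omega_\nu(0)+\omega_e(0)\int_0^t\lambda(a(s))\dot h(s)\,ds\right]+\frac{g}{1+\gamma^2}=0 .$$ If moreover $\mathcal B$ is a solid circular cylinder of radius $R-r>0$ (about any line parallel to $e$), then $\lambda\equiv 1/(R-r)$ and $\ddot h+c_0h+c_1=0$, where $$c_0=\frac{\gamma^2}{1+\gamma^2}\left(\frac{r}{R-r}\right)^2\omega_e(0)^2,\qquad c_1=\frac{\gamma^2}{1+\gamma^2}\,\frac{r^2}{R-r}\,\omega_e(0)\left(\omega_\nu(0)-\frac{1}{R-r}\,\omega_e(0)h(0)\right)+\frac{g}{1+\gamma^2}.$$ If in addition $\omega_e(0)\ne0$, then $c_0>0$ and there are constants $C_1,C_2\in\mathbb R$ with $h(t)=-\frac{c_1}{c_0}+C_1\cos(\sqrt{c_0}\,t)+C_2\sin(\sqrt{c_0}\,t)$ for all $t\in I$: the height undergoes simple harmonic oscillation.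 -/

import Mathlib

open Set MeasureTheory
open scoped InnerProductSpace

noncomputable section

namespace RollingBall

open scoped ContDiff

variable {V : Type*} [NormedAddCommGroup V] [InnerProductSpace ℝ V] [CompleteSpace V]

/-- The ambient vector space `End(V) × V` of the configuration space of a ball in a Euclidean (finite-dimensional) space
`V`: a configuration is a pair `(A, a)` with `A` a rotation and `a` the centre of mass.  Tangent
vectors `(U A, u)` also live here. -/
abbrev Amb (V : Type*) [NormedAddCommGroup V] [InnerProductSpace ℝ V] : Type _ := (V →L[ℝ] V) × V

/-! ### Cylinders and their boundary -/

/-- `B` is invariant under all translations along the unit vector `e`. -/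
def IsSolidCylinder (B : Set V) (e : V) : Prop :=
  ‖e‖ = 1 ∧ ∀ a ∈ B, ∀ s : ℝ, a + s • e ∈ B

/-- On the open set `W`, the function `ρ` is smooth, has no critical point, and `B` is
`{ρ ≥ 0}`. -/
def IsLocalDefiningFunction (B W : Set V) (ρ : V → ℝ) : Prop :=
  IsOpen W ∧ ContDiffOn ℝ ∞ ρ W ∧ ∀ x ∈ W, gradient ρ x ≠ 0 ∧ (x ∈ B ↔ 0 ≤ ρ x)

/-- The boundary of `B` is a smooth hypersurface (with `B` locally on one side of it), and `ν` is
its unit normal field pointing into `B`.  Only the values of `ν` on `frontier B` matter. -/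
def IsSmoothWithInwardNormal (B : Set V) (ν : V → V) : Prop :=
  ∀ a ∈ frontier B, ∃ (W : Set V) (ρ : V → ℝ), a ∈ W ∧ IsLocalDefiningFunction B W ρ ∧
    ∀ x ∈ frontier B ∩ W, ν x = ‖gradient ρ x‖⁻¹ • gradient ρ x

/-- The shape operator `v ↦ - D_v ν` of the hypersurface `S` with unit normal field `ν`, for `v`
tangent to `S` at `a`.  (All derivatives of `ν` within `S` agree on the tangent space of `S`,
so the value at a tangent vector is the derivative of `ν` along any curve in `S` with that
velocity; the value at other vectors has no meaning and is never used.) -/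
def shapeOperator (S : Set V) (ν : V → V) (a v : V) : V :=
  -(fderivWithin ℝ ν S a v)

/-- The normal curvature of `S` at `a` in the direction of the unit tangent vector `v`; it is the
principal curvature when `v` is a principal vector. -/
def normalCurvature (S : Set V) (ν : V → V) (a v : V) : ℝ :=
  ⟪shapeOperator S ν a v, v⟫_ℝ

/-- The solid circular cylinder of radius `d` about the line through `c` with direction `e`. -/
def circularCylinder (c e : V) (d : ℝ) : Set V :=
  {x | ‖(x - c) - ⟪x - c, e⟫_ℝ • e‖ ≤ d}

/-! ### Kinetic energy metric, no-slip bundle, constrained Newton equation -/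

/-- `A` is a rotation of `V`. -/
def IsRotation (A : V →L[ℝ] V) : Prop :=
  ContinuousLinearMap.adjoint A ∘L A = ContinuousLinearMap.id ℝ V ∧
    LinearMap.det (A : V →ₗ[ℝ] V) = 1

/-- The map `U` is in `so(n)`. -/
def IsSkew (U : V →L[ℝ] V) : Prop := ContinuousLinearMap.adjoint U = -U

/-- The kinetic energy metric.  On tangent vectors `(U A, u)`, `(W A, w)` at `(A, a)`, with `A` a
rotation, it is `m ((rγ)²/2 · Tr (U Wᵀ) + u · w)`, because `(U A) (W A)ᵀ = U Wᵀ`. -/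
def kinetic (m r γ : ℝ) (ξ η : Amb V) : ℝ :=
  m * ((r * γ) ^ 2 / 2 *
      LinearMap.trace ℝ V ((ξ.1 ∘L ContinuousLinearMap.adjoint η.1 : V →L[ℝ] V) : V →ₗ[ℝ] V)
    + ⟪ξ.2, η.2⟫_ℝ)

/-- The tangent space at `q = (A, a)` of the boundary configuration manifold `SO(n) × S`, where `ν`
is the unit normal field of `S`. -/
def tangentSpace (ν : V → V) (q : Amb V) : Set (Amb V) :=
  {ξ | (∃ U, IsSkew U ∧ ξ.1 = U ∘L q.1) ∧ ⟪ξ.2, ν q.2⟫_ℝ = 0}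

/-- The no-slip space at `q = (A, a)`: the tangent vectors `(U A, u)` with `u = r U ν(a)`. -/
def noSlip (r : ℝ) (ν : V → V) (q : Amb V) : Set (Amb V) :=
  {ξ | ξ ∈ tangentSpace ν q ∧ ∃ U, IsSkew U ∧ ξ.1 = U ∘L q.1 ∧ ξ.2 = r • U (ν q.2)}

/-- The vectors tangent to `SO(n) × S` that are orthogonal to the no-slip space with respect to
the kinetic energy metric. -/
def noSlipPerp (m r γ : ℝ) (ν : V → V) (q : Amb V) : Set (Amb V) :=
  {ξ | ξ ∈ tangentSpace ν q ∧ ∀ η ∈ noSlip r ν q, kinetic m r γ ξ η = 0}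

/-- `Z` is the covariant acceleration `∇q̇/dt` at time `t` of the curve `q` in `SO(n) × S`, for the
Levi-Civita connection of the kinetic energy metric.  As that metric is the restriction to
`SO(n) × S` of the constant inner product `kinetic` of the ambient vector space, `∇q̇/dt` is the
tangential part, orthogonal for `kinetic`, of the ordinary second derivative. -/
def IsCovariantAcceleration (m r γ : ℝ) (ν : V → V) (q : ℝ → Amb V) (t : ℝ) (Z : Amb V) : Prop :=
  Z ∈ tangentSpace ν (q t) ∧
    ∀ ξ ∈ tangentSpace ν (q t), kinetic m r γ (deriv (deriv q) t - Z) ξ = 0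

/-- The smooth path `q : I → SO(n) × S` satisfies the constrained Newton equation with force
field `f` and the no-slip constraint: `q̇` is in the no-slip bundle and `∇q̇/dt = m⁻¹ f + N` with
`N` in the orthogonal complement of the no-slip bundle. -/
def ConstrainedNewton (m r γ : ℝ) (S : Set V) (ν : V → V) (f : Amb V → Amb V) (I : Set ℝ)
    (q : ℝ → Amb V) : Prop :=
  ContDiffOn ℝ ∞ q I ∧
  ∀ t ∈ I, IsRotation (q t).1 ∧ (q t).2 ∈ S ∧ deriv q t ∈ noSlip r ν (q t) ∧
    ∃ N ∈ noSlipPerp m r γ ν (q t),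
      IsCovariantAcceleration m r γ ν q t (m⁻¹ • f (q t) + N)

/-- The constant force `-m g e`, which acts on the centre of mass only. -/
def gravity (m g : ℝ) (e : V) : Amb V → Amb V := fun _ => (0, -(m * g) • e)

/-- The infinitesimal rotation `U = Ȧ A⁻¹` (where `A⁻¹` is the transpose of `A`). -/
def angularMap (q : ℝ → Amb V) (t : ℝ) : V →L[ℝ] V :=
  (deriv q t).1 ∘L ContinuousLinearMap.adjoint (q t).1

/-- The velocity of the centre of mass. -/
def vel (q : ℝ → Amb V) (t : ℝ) : V := (deriv q t).2

/-- The height of the centre of mass. -/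
def height (e : V) (q : ℝ → Amb V) (t : ℝ) : ℝ := ⟪(q t).2, e⟫_ℝ

/-! ### Dimension three -/

/-- Oriented Euclidean space of dimension three. -/
abbrev E3 : Type := EuclideanSpace ℝ (Fin 3)

/-- The usual vector product of `ℝ³`. -/
def cross (x y : E3) : E3 := WithLp.toLp 2 (crossProduct x.ofLp y.ofLp)

/-- The unit tangent vector `τ = ν × e`, so that `τ, ν, e` is a positive orthonormal frame. -/
def tau (ν : E3 → E3) (e : E3) (a : E3) : E3 := cross (ν a) e

/-- The curvature `λ(a)` of `S` at `a` in the direction `τ`. -/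
def curvature (S : Set E3) (ν : E3 → E3) (e : E3) (a : E3) : ℝ :=
  normalCurvature S ν a (tau ν e a)

end RollingBall

end

open RollingBall

/-! Testing Newton's equation with the no-slip vectors `(η × A, r η × ν)` eliminates the constraint
force, and letting `η` vary turns it into one vector equation, `r γ² ω' + ν × (u' + g e) = 0`
(`exists_angular_acceleration`). The term `ω × (ω × ·)` in the second derivative of `A` is
symmetric, so it drops out of the trace against a skew map.

The geometry of the cylinder enters only through the frame `τ, ν, e`. Since `ν` is invariant along
`e`, the shape operator kills `e` and has `τ` as eigenvector. The no-slip condition gives `u · τ =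
-r ω · e` and `u · e = r ω · τ`, so along the path `ν' = r λ (ω · e) τ` and `τ' = -r λ (ω · e) ν`.

Differentiating the two no-slip identities and comparing with the `e` and `τ` components of the
vector equation gives the conservation of `ω · e` and the equation of `u · e`; the `ν` component
gives that of `ω · ν` (`hasDerivAt_rolling`). Integrating the last one yields the equation of the
height. On a circular cylinder `λ` is constant, the integral is a multiple of the change of height,
and the equation becomes that of a harmonic oscillator (`exists_harmonic`). -/

noncomputable section

namespace RollingBall

open scoped Topology
open Filter

/-! ### Hypersurfaces bounding a region, their normals and shape operators. -/

section Geometry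

open scoped ContDiff

variable {V : Type*} [NormedAddCommGroup V] [InnerProductSpace ℝ V]

lemma tendsto_line_nhds (a v : V) : Tendsto (fun t : ℝ => a + t • v) (𝓝[>] 0) (𝓝 a) := by
  have : Continuous fun t : ℝ => a + t • v := by fun_prop
  simpa using (this.tendsto 0).mono_left nhdsWithin_le_nhds

namespace IsSolidCylinder

variable {B : Set V} {a e : V}

lemma mem_add_smul_iff (hB : IsSolidCylinder B e) (s : ℝ) : a + s • e ∈ B ↔ a ∈ B := by
  refine ⟨fun h => ?_, fun h => hB.2 a h s⟩
  simpa using hB.2 _ h (-s)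

lemma add_smul_mem_frontier (hB : IsSolidCylinder B e) (ha : a ∈ frontier B) (s : ℝ) :
    a + s • e ∈ frontier B := by
  have h : (Homeomorph.addRight (s • e)) ⁻¹' B = B := by
    ext x; exact hB.mem_add_smul_iff s
  rw [← h, ← Homeomorph.preimage_frontier] at ha
  exact ha

lemma hasDerivAt_line (a e : V) : HasDerivAt (fun t : ℝ => a + t • e) e 0 := by
  simpa using ((hasDerivAt_id (0 : ℝ)).smul_const e).const_add a

end IsSolidCylinder

variable [CompleteSpace V]

lemma HasDerivAt.eventually_pos_right {f : ℝ → ℝ} {d : ℝ} (hf : HasDerivAt f d 0) (h0 : f 0 = 0)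
    (hd : 0 < d) : ∀ᶠ t in 𝓝[>] (0 : ℝ), 0 < f t := by
  have h := hasDerivWithinAt_iff_tendsto_slope' (by simp) |>.1 (hf.hasDerivWithinAt (s := Ioi 0))
  filter_upwards [h.eventually (lt_mem_nhds hd), self_mem_nhdsWithin] with t ht ht0
  rw [slope_def_field, h0, sub_zero, sub_zero] at ht
  exact (div_pos_iff_of_pos_right ht0).1 ht

lemma HasDerivAt.nonneg_of_eventually_nonneg_right {f : ℝ → ℝ} {d : ℝ} (hf : HasDerivAt f d 0)
    (h0 : f 0 = 0) (h : ∀ᶠ t in 𝓝[>] (0 : ℝ), 0 ≤ f t) : 0 ≤ d := by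
  have hs := hasDerivWithinAt_iff_tendsto_slope' (by simp) |>.1 (hf.hasDerivWithinAt (s := Ioi 0))
  refine ge_of_tendsto hs ?_
  filter_upwards [h, self_mem_nhdsWithin] with t ht ht0
  rw [slope_def_field, h0, sub_zero, sub_zero]
  exact div_nonneg ht (le_of_lt ht0)

lemma HasGradientAt.hasDerivAt_line {ρ : V → ℝ} {G a : V} (h : HasGradientAt ρ G a) (v : V) :
    HasDerivAt (fun t : ℝ => ρ (a + t • v)) ⟪G, v⟫_ℝ 0 := by
  have hl : HasDerivAt (fun t : ℝ => a + t • v) v 0 := by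
    simpa using ((hasDerivAt_id (0 : ℝ)).smul_const v).const_add a
  have := h.hasFDerivAt.comp_hasDerivAt_of_eq 0 hl (by simp)
  simpa using! this

namespace IsLocalDefiningFunction

variable {B W : Set V} {ρ : V → ℝ}

lemma contDiffAt (h : IsLocalDefiningFunction B W ρ) {x : V} (hx : x ∈ W) :
    ContDiffAt ℝ ∞ ρ x :=
  h.2.1.contDiffAt (h.1.mem_nhds hx)

lemma hasGradientAt (h : IsLocalDefiningFunction B W ρ) {x : V} (hx : x ∈ W) :
    HasGradientAt ρ (gradient ρ x) x :=
  ((h.contDiffAt hx).differentiableAt (by simp)).hasGradientAt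

lemma mem_frontier_iff (h : IsLocalDefiningFunction B W ρ) {x : V} (hx : x ∈ W) :
    x ∈ frontier B ↔ ρ x = 0 := by
  have hW := h.1.mem_nhds hx
  have hc := (h.contDiffAt hx).continuousAt
  constructor
  · intro hf
    rcases lt_trichotomy (ρ x) 0 with hlt | heq | hgt
    · exfalso
      have : ∀ᶠ y in 𝓝 x, y ∈ Bᶜ := by
        filter_upwards [hW, hc.eventually (gt_mem_nhds hlt)] with y hy hy'
        exact fun hyB => not_le.2 hy' ((h.2.2 y hy).2.1 hyB)
      exact (mem_closure_iff_frequently.1 hf.1) this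
    · exact heq
    · exfalso
      refine hf.2 (mem_interior_iff_mem_nhds.2 ?_)
      filter_upwards [hW, hc.eventually (lt_mem_nhds hgt)] with y hy hy'
      exact (h.2.2 y hy).2.2 hy'.le
  · intro h0
    refine ⟨subset_closure ((h.2.2 x hx).2.2 h0.ge), fun hi => (h.2.2 x hx).1 ?_⟩
    -- A zero of `ρ` interior to `B` would be a local minimum, hence a critical point.
    have hmin : IsLocalMin ρ x := by
      filter_upwards [hW, mem_interior_iff_mem_nhds.1 hi] with y hy hyB
      rw [h0]
      exact (h.2.2 y hy).2.1 hyB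
    simp [gradient, hmin.fderiv_eq_zero]

lemma contDiffOn_gradient (h : IsLocalDefiningFunction B W ρ) : ContDiffOn ℝ ∞ (gradient ρ) W := by
  have h1 : ContDiffOn ℝ ∞ (fderiv ℝ ρ) W := h.2.1.fderiv_of_isOpen h.1 (by simp)
  exact (InnerProductSpace.toDual ℝ V).symm.contDiff.comp_contDiffOn h1

/-- Every vector orthogonal to the gradient is the velocity of a curve in the hypersurface. -/
lemma exists_curve (h : IsLocalDefiningFunction B W ρ) {a v : V} (ha : a ∈ W)
    (hf : a ∈ frontier B) (hv : ⟪gradient ρ a, v⟫_ℝ = 0) :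
    ∃ c : ℝ → V, c 0 = a ∧ HasDerivAt c v 0 ∧ ∀ᶠ t in 𝓝 (0 : ℝ), c t ∈ frontier B := by
  have hs : HasStrictFDerivAt ρ (fderiv ℝ ρ a) a :=
    (h.contDiffAt ha).hasStrictFDerivAt (by simp)
  have hne : fderiv ℝ ρ a ≠ 0 := fun h0 => (h.2.2 a ha).1 (by simp [gradient, h0])
  have hr : (fderiv ℝ ρ a).range = ⊤ :=
    LinearMap.range_eq_top.2 (LinearMap.surjective fun h0 => hne (by ext x; exact congr($h0 x)))
  have hk : fderiv ℝ ρ a v = 0 := by rw [← inner_gradient_left]; exact hv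
  let w : (fderiv ℝ ρ a).ker := ⟨v, hk⟩
  -- The implicit function parametrizes the level set of `ρ` over the kernel of its differential,
  -- and its derivative at the origin is the inclusion of the kernel.
  let c : ℝ → V := fun t => hs.implicitFunction ρ (fderiv ℝ ρ a) hr (ρ a) (t • w)
  have hc0 : c 0 = a := by simp [c]
  have hcd : HasDerivAt c v 0 := by
    have hl : HasDerivAt (fun t : ℝ => t • w) w 0 := by
      simpa using (hasDerivAt_id (0 : ℝ)).smul_const w
    exact (hs.to_implicitFunction hr).hasFDerivAt.comp_hasDerivAt_of_eq 0 hl (by simp)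
  refine ⟨c, hc0, hcd, ?_⟩
  have ht : Tendsto (fun t : ℝ => (ρ a, t • w)) (𝓝 0) (𝓝 (ρ a, 0)) := by
    have : Continuous fun t : ℝ => (ρ a, t • w) := by fun_prop
    simpa using this.tendsto 0
  have hcW : ∀ᶠ t in 𝓝 (0 : ℝ), c t ∈ W :=
    hcd.continuousAt.eventually (by rw [hc0]; exact h.1.mem_nhds ha)
  filter_upwards [ht.eventually (hs.map_implicitFunction_eq hr), hcW] with t h1 h2
  rw [h.mem_frontier_iff h2]
  exact h1.trans ((h.mem_frontier_iff ha).1 hf)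

end IsLocalDefiningFunction

namespace IsSmoothWithInwardNormal

variable {B : Set V} {ν : V → V} {a : V}

/-- The unit normal field extends locally to a smooth field of unit vectors. -/
lemma exists_extension (hν : IsSmoothWithInwardNormal B ν) (ha : a ∈ frontier B) :
    ∃ (W : Set V) (n : V → V), IsOpen W ∧ a ∈ W ∧ ContDiffOn ℝ ∞ n W ∧ (∀ x ∈ W, ‖n x‖ = 1) ∧
      ∀ x ∈ frontier B ∩ W, ν x = n x := by
  obtain ⟨W, ρ, haW, hρ, hνW⟩ := hν a ha
  refine ⟨W, fun x => ‖gradient ρ x‖⁻¹ • gradient ρ x, hρ.1, haW, ?_, fun x hx => ?_, hνW⟩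
  · have hg := hρ.contDiffOn_gradient
    exact ((hg.norm ℝ fun x hx => (hρ.2.2 x hx).1).inv
      fun x hx => norm_ne_zero_iff.2 (hρ.2.2 x hx).1).smul hg
  · simp [norm_smul, (hρ.2.2 x hx).1]

lemma norm_eq_one (hν : IsSmoothWithInwardNormal B ν) (ha : a ∈ frontier B) : ‖ν a‖ = 1 := by
  obtain ⟨W, n, -, haW, -, hn, hνn⟩ := hν.exists_extension ha
  rw [hνn a ⟨ha, haW⟩, hn a haW]

lemma differentiableWithinAt (hν : IsSmoothWithInwardNormal B ν) (ha : a ∈ frontier B) :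
    DifferentiableWithinAt ℝ ν (frontier B) a := by
  obtain ⟨W, n, hW, haW, hn, -, hνn⟩ := hν.exists_extension ha
  have h1 : DifferentiableAt ℝ n a := (hn.contDiffAt (hW.mem_nhds haW)).differentiableAt (by simp)
  refine h1.differentiableWithinAt.congr_of_eventuallyEq ?_ (hνn a ⟨ha, haW⟩)
  filter_upwards [self_mem_nhdsWithin, mem_nhdsWithin_of_mem_nhds (hW.mem_nhds haW)] with x h1 h2
  exact hνn x ⟨h1, h2⟩

/-- The chain rule along a curve in `frontier B` is valid for any derivative within that set, so the
choice made by `fderivWithin` does not matter. -/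
lemma hasDerivAt_comp (hν : IsSmoothWithInwardNormal B ν) {c : ℝ → V} {v : V} {t : ℝ}
    (hc : HasDerivAt c v t) (hS : ∀ᶠ s in 𝓝 t, c s ∈ frontier B) :
    HasDerivAt (fun s => ν (c s)) (-shapeOperator (frontier B) ν (c t) v) t := by
  have := (hν.differentiableWithinAt hS.self_of_nhds).hasFDerivWithinAt.comp_hasDerivAt t hc hS
  simpa [shapeOperator] using! this

lemma exists_curve (hν : IsSmoothWithInwardNormal B ν) {v : V} (ha : a ∈ frontier B)
    (hv : ⟪ν a, v⟫_ℝ = 0) :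
    ∃ c : ℝ → V, c 0 = a ∧ HasDerivAt c v 0 ∧ ∀ᶠ t in 𝓝 (0 : ℝ), c t ∈ frontier B := by
  obtain ⟨W, ρ, haW, hρ, hνW⟩ := hν a ha
  refine hρ.exists_curve haW ha ?_
  rw [hνW a ⟨ha, haW⟩, real_inner_smul_left] at hv
  exact (mul_eq_zero.1 hv).resolve_left
    (inv_ne_zero (norm_ne_zero_iff.2 (hρ.2.2 a haW).1))

/-- If `ν` agrees on the hypersurface with a differentiable field, then the shape operator is
minus the derivative of that field on tangent vectors. -/
lemma shapeOperator_eq_neg_of_hasFDerivAt (hν : IsSmoothWithInwardNormal B ν) {n : V → V}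
    {n' : V →L[ℝ] V} {v : V} (ha : a ∈ frontier B) (hv : ⟪ν a, v⟫_ℝ = 0)
    (hn : HasFDerivAt n n' a) (hνn : ∀ᶠ x in 𝓝 a, x ∈ frontier B → ν x = n x) :
    shapeOperator (frontier B) ν a v = -n' v := by
  obtain ⟨c, hc0, hcd, hcS⟩ := hν.exists_curve ha hv
  have h1 := hν.hasDerivAt_comp hcd hcS
  have h2 := hn.comp_hasDerivAt_of_eq 0 hcd hc0.symm
  have hev : (fun s => ν (c s)) =ᶠ[𝓝 0] n ∘ c := by
    have : ∀ᶠ t in 𝓝 (0 : ℝ), c t ∈ frontier B → ν (c t) = n (c t) :=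
      hcd.continuousAt.eventually (by rw [hc0]; exact hνn)
    filter_upwards [this, hcS] with t ht htS using ht htS
  have := h1.unique (h2.congr_of_eventuallyEq hev)
  rw [hc0] at this
  rw [← this, neg_neg]

/-- A direction `v` with `ν a · v > 0` enters `B`, where `ρ ≥ 0`, so `G · v ≥ 0`. If `ν a` differed
from the normalized `N` of `G`, then `v = ν a - N` would contradict this. Hence one-sided
information on `ρ` is enough to identify the inward normal. -/
lemma eq_of_nonneg_on (hν : IsSmoothWithInwardNormal B ν) {ρ : V → ℝ} {G : V}
    (ha : a ∈ frontier B) (hG : HasGradientAt ρ G a) (hG0 : G ≠ 0) (h0 : ρ a = 0)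
    (hpos : ∀ᶠ x in 𝓝 a, x ∈ B → 0 ≤ ρ x) : ν a = ‖G‖⁻¹ • G := by
  obtain ⟨W, σ, haW, hσ, hνW⟩ := hν a ha
  have key : ∀ v, 0 < ⟪ν a, v⟫_ℝ → 0 ≤ ⟪G, v⟫_ℝ := by
    intro v hv
    rw [hνW a ⟨ha, haW⟩, real_inner_smul_left] at hv
    have hv' : 0 < ⟪gradient σ a, v⟫_ℝ := pos_of_mul_pos_right hv (by positivity)
    have hσ0 := (hσ.mem_frontier_iff haW).1 ha
    have h1 := HasDerivAt.eventually_pos_right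
      (HasGradientAt.hasDerivAt_line (hσ.hasGradientAt haW) v) (by simpa using hσ0) hv'
    refine HasDerivAt.nonneg_of_eventually_nonneg_right
      (HasGradientAt.hasDerivAt_line hG v) (by simpa using h0) ?_
    have hl := tendsto_line_nhds a v
    filter_upwards [h1, hl.eventually (hσ.1.mem_nhds haW), hl.eventually hpos] with t ht1 ht2 ht3
    exact ht3 ((hσ.2.2 _ ht2).2.2 ht1.le)
  have hνa := hν.norm_eq_one ha
  have hGn : 0 < ‖G‖ := norm_pos_iff.2 hG0
  set N := ‖G‖⁻¹ • G with hN
  have hN1 : ‖N‖ = 1 := by simp [hN, norm_smul, hGn.ne']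
  have hGN : G = ‖G‖ • N := by rw [hN, smul_smul, mul_inv_cancel₀ hGn.ne', one_smul]
  by_contra hne
  have hlt : ⟪ν a, N⟫_ℝ < 1 := (inner_lt_one_iff_real_of_norm_eq_one hνa hN1).2 hne
  have h1 : 0 < ⟪ν a, ν a - N⟫_ℝ := by
    rw [inner_sub_right, real_inner_self_eq_norm_sq, hνa]; linarith
  have h2 := key _ h1
  rw [hGN, real_inner_smul_left, inner_sub_right, real_inner_self_eq_norm_sq, hN1,
    real_inner_comm] at h2
  nlinarith

/-- Differentiate `ν · ν = 1` along a curve in the boundary. -/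
lemma inner_shapeOperator_self (hν : IsSmoothWithInwardNormal B ν) {v : V} (ha : a ∈ frontier B)
    (hv : ⟪ν a, v⟫_ℝ = 0) : ⟪ν a, shapeOperator (frontier B) ν a v⟫_ℝ = 0 := by
  obtain ⟨c, hc0, hcd, hcS⟩ := hν.exists_curve ha hv
  have h1 := hν.hasDerivAt_comp hcd hcS
  have h2 := h1.inner ℝ h1
  have hev : (fun t => ⟪ν (c t), ν (c t)⟫_ℝ) =ᶠ[𝓝 0] fun _ => 1 := by
    filter_upwards [hcS] with t ht
    rw [real_inner_self_eq_norm_sq, hν.norm_eq_one ht]; norm_num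
  have h3 := h2.unique ((hasDerivAt_const (0 : ℝ) (1 : ℝ)).congr_of_eventuallyEq hev)
  rw [hc0, inner_neg_right, inner_neg_left, real_inner_comm] at h3
  rw [real_inner_comm]; linarith

end IsSmoothWithInwardNormal

namespace IsSolidCylinder

variable {B : Set V} {ν : V → V} {a e : V}

lemma inner_normal_axis (hB : IsSolidCylinder B e) (hν : IsSmoothWithInwardNormal B ν)
    (ha : a ∈ frontier B) : ⟪ν a, e⟫_ℝ = 0 := by
  obtain ⟨W, ρ, haW, hρ, hνW⟩ := hν a ha
  have h1 := HasGradientAt.hasDerivAt_line (hρ.hasGradientAt haW) e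
  have hev : (fun t : ℝ => ρ (a + t • e)) =ᶠ[𝓝 0] fun _ => 0 := by
    have : ∀ᶠ t : ℝ in 𝓝 0, a + t • e ∈ W :=
      (hasDerivAt_line a e).continuousAt.eventually (by simpa using hρ.1.mem_nhds haW)
    filter_upwards [this] with t ht
    exact (hρ.mem_frontier_iff ht).1 (hB.add_smul_mem_frontier ha t)
  have h2 := h1.unique ((hasDerivAt_const (0 : ℝ) (0 : ℝ)).congr_of_eventuallyEq hev)
  rw [hνW a ⟨ha, haW⟩, real_inner_smul_left, h2, mul_zero]

/-- A defining function at `a`, translated by `s • e`, is nonnegative on `B` near `a + s • e` and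
has the same gradient there. -/
lemma normal_add_smul (hB : IsSolidCylinder B e) (hν : IsSmoothWithInwardNormal B ν)
    (ha : a ∈ frontier B) (s : ℝ) : ν (a + s • e) = ν a := by
  obtain ⟨W, ρ, haW, hρ, hνW⟩ := hν a ha
  have hsub : ∀ x : V, HasFDerivAt (fun x => x - s • e) (ContinuousLinearMap.id ℝ V) x :=
    fun x => (hasFDerivAt_id x).sub_const _
  rw [hνW a ⟨ha, haW⟩]
  refine hν.eq_of_nonneg_on (ρ := fun x => ρ (x - s • e)) (hB.add_smul_mem_frontier ha s) ?_
    (hρ.2.2 a haW).1 ?_ ?_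
  · rw [hasGradientAt_iff_hasFDerivAt]
    have h1 : HasFDerivAt ρ (InnerProductSpace.toDual ℝ V (gradient ρ a)) (a + s • e - s • e) := by
      rw [add_sub_cancel_right]; exact (hρ.hasGradientAt haW).hasFDerivAt
    simpa using! h1.comp (a + s • e) (hsub (a + s • e))
  · simpa using (hρ.mem_frontier_iff haW).1 ha
  · have : ∀ᶠ x in 𝓝 (a + s • e), x - s • e ∈ W :=
      (hsub (a + s • e)).continuousAt.eventually (by simpa using hρ.1.mem_nhds haW)
    filter_upwards [this] with x hx hxB
    refine (hρ.2.2 _ hx).2.1 ?_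
    rw [← hB.mem_add_smul_iff s]
    simpa using hxB

lemma shapeOperator_axis (hB : IsSolidCylinder B e) (hν : IsSmoothWithInwardNormal B ν)
    (ha : a ∈ frontier B) : shapeOperator (frontier B) ν a e = 0 := by
  have h1 := hν.hasDerivAt_comp (hasDerivAt_line a e)
    (Eventually.of_forall fun t => hB.add_smul_mem_frontier ha t)
  have h2 : (fun s : ℝ => ν (a + s • e)) = fun _ => ν a :=
    funext fun s => hB.normal_add_smul hν ha s
  rw [h2] at h1
  simpa using (hasDerivAt_const (0 : ℝ) (ν a)).unique h1

/-- Differentiate `ν · e = 0` along a curve in the boundary. With `inner_shapeOperator_self`, this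
leaves only the direction `τ` for the image of the shape operator. -/
lemma inner_shapeOperator_axis (hB : IsSolidCylinder B e) (hν : IsSmoothWithInwardNormal B ν)
    {v : V} (ha : a ∈ frontier B) (hv : ⟪ν a, v⟫_ℝ = 0) :
    ⟪shapeOperator (frontier B) ν a v, e⟫_ℝ = 0 := by
  obtain ⟨c, hc0, hcd, hcS⟩ := hν.exists_curve ha hv
  have h1 := (hν.hasDerivAt_comp hcd hcS).inner ℝ (hasDerivAt_const (0 : ℝ) e)
  have hev : (fun t => ⟪ν (c t), e⟫_ℝ) =ᶠ[𝓝 0] fun _ => 0 := by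
    filter_upwards [hcS] with t ht using hB.inner_normal_axis hν ht
  have h3 := h1.unique ((hasDerivAt_const (0 : ℝ) (0 : ℝ)).congr_of_eventuallyEq hev)
  simpa [hc0, inner_neg_left] using h3

end IsSolidCylinder

end Geometry

/-! ### Vector algebra in dimension three. -/

section Cross

lemma inner_coord (x y : E3) : ⟪x, y⟫_ℝ = x 0 * y 0 + x 1 * y 1 + x 2 * y 2 := by
  simp [PiLp.inner_apply, Fin.sum_univ_three, mul_comm]

@[simp] lemma cross_zero_coord (x y : E3) : cross x y 0 = x 1 * y 2 - x 2 * y 1 := by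
  simp [cross, crossProduct]

@[simp] lemma cross_one_coord (x y : E3) : cross x y 1 = x 2 * y 0 - x 0 * y 2 := by
  simp [cross, crossProduct]

@[simp] lemma cross_two_coord (x y : E3) : cross x y 2 = x 0 * y 1 - x 1 * y 0 := by
  simp [cross, crossProduct]

lemma ext_coord {x y : E3} (h0 : x 0 = y 0) (h1 : x 1 = y 1) (h2 : x 2 = y 2) : x = y := by
  ext i; fin_cases i <;> assumption

/-- The vector product with a fixed right factor. -/
def crossRight (y : E3) : E3 →L[ℝ] E3 :=
  LinearMap.toContinuousLinearMap
    { toFun := fun x => cross x y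
      map_add' := fun a b => by apply ext_coord <;> simp <;> ring
      map_smul' := fun c a => by apply ext_coord <;> simp <;> ring }

/-- The vector product with a fixed left factor. -/
def crossLeft (x : E3) : E3 →L[ℝ] E3 :=
  LinearMap.toContinuousLinearMap
    { toFun := fun y => cross x y
      map_add' := fun a b => by apply ext_coord <;> simp <;> ring
      map_smul' := fun c a => by apply ext_coord <;> simp <;> ring }

@[simp] lemma crossRight_apply (x y : E3) : crossRight y x = cross x y := rfl

@[simp] lemma crossLeft_apply (x y : E3) : crossLeft x y = cross x y := rfl

lemma inner_cross_perm (x y z : E3) : ⟪x, cross y z⟫_ℝ = ⟪cross z x, y⟫_ℝ := by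
  simp only [inner_coord, cross_zero_coord, cross_one_coord, cross_two_coord]; ring

lemma inner_cross_self (x y : E3) : ⟪x, cross x y⟫_ℝ = 0 := by
  simp only [inner_coord, cross_zero_coord, cross_one_coord, cross_two_coord]; ring

lemma inner_self_cross (x y : E3) : ⟪y, cross x y⟫_ℝ = 0 := by
  simp only [inner_coord, cross_zero_coord, cross_one_coord, cross_two_coord]; ring

lemma cross_cross (x y z : E3) : cross x (cross y z) = ⟪x, z⟫_ℝ • y - ⟪x, y⟫_ℝ • z := by
  apply ext_coord <;> simp [inner_coord] <;> ring

lemma cross_anticomm (x y : E3) : cross x y = -cross y x := by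
  apply ext_coord <;> simp <;> ring

lemma isSkew_crossLeft (x : E3) : IsSkew (crossLeft x) := by
  refine (ContinuousLinearMap.eq_adjoint_iff _ _).2 (fun y z => ?_) |>.symm
  simp only [neg_apply, crossLeft_apply, inner_coord, cross_zero_coord,
    cross_one_coord, cross_two_coord, PiLp.neg_apply]
  ring

/-- The square of a triple product is a Gram determinant. -/
lemma inner_cross_sq (y n e : E3) :
    ⟪y, cross n e⟫_ℝ ^ 2 =
      ⟪y, y⟫_ℝ * (⟪n, n⟫_ℝ * ⟪e, e⟫_ℝ - ⟪n, e⟫_ℝ ^ 2)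
        - ⟪y, n⟫_ℝ * (⟪y, n⟫_ℝ * ⟪e, e⟫_ℝ - ⟪n, e⟫_ℝ * ⟪y, e⟫_ℝ)
        + ⟪y, e⟫_ℝ * (⟪y, n⟫_ℝ * ⟪n, e⟫_ℝ - ⟪n, n⟫_ℝ * ⟪y, e⟫_ℝ) := by
  simp only [inner_coord, cross_zero_coord, cross_one_coord, cross_two_coord]; ring

variable {n e : E3}

lemma eq_smul_cross_of_orthogonal (hn : ‖n‖ = 1) (he : ‖e‖ = 1) (hne : ⟪n, e⟫_ℝ = 0) {x : E3}
    (hxn : ⟪x, n⟫_ℝ = 0) : x = ⟪x, e⟫_ℝ • e + ⟪x, cross n e⟫_ℝ • cross n e := by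
  have hnn : ⟪n, n⟫_ℝ = 1 := by rw [real_inner_self_eq_norm_sq, hn]; norm_num
  have hee : ⟪e, e⟫_ℝ = 1 := by rw [real_inner_self_eq_norm_sq, he]; norm_num
  have htt : ⟪cross n e, cross n e⟫_ℝ = 1 := by
    have h := inner_cross_sq (cross n e) n e
    have h1 : ⟪cross n e, n⟫_ℝ = 0 := by rw [real_inner_comm]; exact inner_cross_self n e
    have h2 : ⟪cross n e, e⟫_ℝ = 0 := by rw [real_inner_comm]; exact inner_self_cross n e
    have h3 : ⟪cross n e, cross n e⟫_ℝ = ⟪n, n⟫_ℝ * ⟪e, e⟫_ℝ - ⟪n, e⟫_ℝ ^ 2 := by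
      simp only [inner_coord, cross_zero_coord, cross_one_coord, cross_two_coord]; ring
    rw [h3, hnn, hee, hne]; norm_num
  have h1 : ⟪cross n e, n⟫_ℝ = 0 := by rw [real_inner_comm]; exact inner_cross_self n e
  have h2 : ⟪cross n e, e⟫_ℝ = 0 := by rw [real_inner_comm]; exact inner_self_cross n e
  set y := x - (⟪x, e⟫_ℝ • e + ⟪x, cross n e⟫_ℝ • cross n e) with hy
  have y1 : ⟪y, n⟫_ℝ = 0 := by
    rw [hy, inner_sub_left, inner_add_left, real_inner_smul_left, real_inner_smul_left, h1, hxn,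
      real_inner_comm n e, hne]; ring
  have y2 : ⟪y, e⟫_ℝ = 0 := by
    rw [hy, inner_sub_left, inner_add_left, real_inner_smul_left, real_inner_smul_left, h2, hee]
    ring
  have y3 : ⟪y, cross n e⟫_ℝ = 0 := by
    rw [hy, inner_sub_left, inner_add_left, real_inner_smul_left, real_inner_smul_left, htt,
      inner_self_cross]
    ring
  -- The remainder `y` is orthogonal to `n`, `e` and `cross n e`, so the Gram identity collapses to
  -- `⟪y, y⟫ = 0`.
  have := inner_cross_sq y n e
  rw [y1, y2, y3, hnn, hee, hne] at this
  have hy0 : ⟪y, y⟫_ℝ = 0 := by linarith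
  exact sub_eq_zero.1 (inner_self_eq_zero.1 hy0)

lemma norm_cross_eq_one (hn : ‖n‖ = 1) (he : ‖e‖ = 1) (hne : ⟪n, e⟫_ℝ = 0) :
    ‖cross n e‖ = 1 := by
  have h3 : ⟪cross n e, cross n e⟫_ℝ = ⟪n, n⟫_ℝ * ⟪e, e⟫_ℝ - ⟪n, e⟫_ℝ ^ 2 := by
    simp only [inner_coord, cross_zero_coord, cross_one_coord, cross_two_coord]; ring
  rw [real_inner_self_eq_norm_sq, real_inner_self_eq_norm_sq, real_inner_self_eq_norm_sq, hn, he,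
    hne] at h3
  have : ‖cross n e‖ ^ 2 = 1 := by rw [h3]; norm_num
  exact (pow_eq_one_iff_of_nonneg (norm_nonneg _) two_ne_zero).1 this

/-- The vector `x` with `x × w = U w`, for a skew map `U`. -/
def axial (U : E3 →L[ℝ] E3) : E3 :=
  WithLp.toLp 2 ![U (EuclideanSpace.single 1 1) 2, U (EuclideanSpace.single 2 1) 0,
    U (EuclideanSpace.single 0 1) 1]

lemma axial_eq {U : E3 →L[ℝ] E3} {x : E3} (h : ∀ w, U w = cross x w) : axial U = x := by
  apply ext_coord <;> simp [axial, h]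

/-- `axial` as a continuous linear map. -/
def axialCLM : (E3 →L[ℝ] E3) →L[ℝ] E3 :=
  LinearMap.toContinuousLinearMap
    { toFun := axial
      map_add' := fun a b => by apply ext_coord <;> simp [axial]
      map_smul' := fun c a => by apply ext_coord <;> simp [axial] }

lemma trace_coord (T : E3 →L[ℝ] E3) :
    LinearMap.trace ℝ E3 (T : E3 →ₗ[ℝ] E3) =
      T (EuclideanSpace.single 0 1) 0 + T (EuclideanSpace.single 1 1) 1
        + T (EuclideanSpace.single 2 1) 2 := by
  rw [LinearMap.trace_eq_sum_inner _ (EuclideanSpace.basisFun (Fin 3) ℝ)]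
  simp [Fin.sum_univ_three, EuclideanSpace.inner_single_left]

end Cross

/-! ### The principal curvature of a cylinder. -/

section Curvature

variable {B : Set E3} {ν : E3 → E3} {e a : E3}

lemma shapeOperator_tau (hB : IsSolidCylinder B e) (hν : IsSmoothWithInwardNormal B ν)
    (ha : a ∈ frontier B) :
    shapeOperator (frontier B) ν a (tau ν e a) = curvature (frontier B) ν e a • tau ν e a := by
  have hv : ⟪ν a, tau ν e a⟫_ℝ = 0 := inner_cross_self _ _
  have h1 := hν.inner_shapeOperator_self ha hv
  have h2 := hB.inner_shapeOperator_axis hν ha hv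
  rw [real_inner_comm] at h1
  have h := eq_smul_cross_of_orthogonal (hν.norm_eq_one ha) hB.1 (hB.inner_normal_axis hν ha) h1
  rw [h2, zero_smul, zero_add] at h
  exact h

lemma shapeOperator_tangent (hB : IsSolidCylinder B e) (hν : IsSmoothWithInwardNormal B ν)
    (ha : a ∈ frontier B) {v : E3} (hv : ⟪v, ν a⟫_ℝ = 0) :
    shapeOperator (frontier B) ν a v =
      (⟪v, tau ν e a⟫_ℝ * curvature (frontier B) ν e a) • tau ν e a := by
  have h := eq_smul_cross_of_orthogonal (hν.norm_eq_one ha) hB.1 (hB.inner_normal_axis hν ha) hv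
  have h1 := shapeOperator_tau hB hν ha
  have h2 := hB.shapeOperator_axis hν ha
  rw [mul_smul, ← h1]
  change v = ⟪v, e⟫_ℝ • e + ⟪v, tau ν e a⟫_ℝ • tau ν e a at h
  conv_lhs => rw [h]
  simp only [shapeOperator, neg_eq_zero] at h2 ⊢
  rw [map_add, map_smul, map_smul, h2]
  simp

/-- Locally the curvature is computed from the ordinary derivative of a smooth extension of `ν`,
which is continuous. This is what makes the integral in the height equation meaningful. -/
lemma continuousOn_curvature (hν : IsSmoothWithInwardNormal B ν) :
    ContinuousOn (curvature (frontier B) ν e) (frontier B) := by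
  intro a ha
  obtain ⟨W, n, hW, haW, hn, -, hνn⟩ := hν.exists_extension ha
  have hWn := hW.mem_nhds haW
  have h1 : ContinuousAt (fderiv ℝ n) a :=
    ((hn.fderiv_of_isOpen hW (m := 0) (by simp)).continuousOn).continuousAt hWn
  have h2 : ContinuousAt (fun x => crossRight e (n x)) a :=
    (crossRight e).continuous.continuousAt.comp (hn.continuousOn.continuousAt hWn)
  have h3 : ContinuousAt
      (fun x => ⟪-(fderiv ℝ n x (crossRight e (n x))), crossRight e (n x)⟫_ℝ) a :=
    ((h1.clm_apply h2).neg).inner (𝕜 := ℝ) h2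
  have key : ∀ x ∈ frontier B ∩ W, curvature (frontier B) ν e x =
      ⟪-(fderiv ℝ n x (crossRight e (n x))), crossRight e (n x)⟫_ℝ := by
    rintro x ⟨hx, hxW⟩
    have hd : HasFDerivAt n (fderiv ℝ n x) x :=
      ((hn.contDiffAt (hW.mem_nhds hxW)).differentiableAt (by simp)).hasFDerivAt
    have := hν.shapeOperator_eq_neg_of_hasFDerivAt (v := tau ν e x) hx (inner_cross_self _ _) hd
      (by filter_upwards [hW.mem_nhds hxW] with y hy hyB using hνn y ⟨hyB, hy⟩)
    rw [curvature, normalCurvature, this, tau, hνn x ⟨hx, hxW⟩, crossRight_apply]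
  refine h3.continuousWithinAt.congr_of_eventuallyEq ?_ (key a ⟨ha, haW⟩)
  filter_upwards [self_mem_nhdsWithin, mem_nhdsWithin_of_mem_nhds hWn] with x hx hxW
  exact key x ⟨hx, hxW⟩

end Curvature

/-! ### Circular cylinders. -/

section CircularCylinder

variable {c e a : E3} {d : ℝ} {ν : E3 → E3}

/-- The orthogonal projection along the unit vector `e`. -/
def projOrth (e : E3) : E3 →L[ℝ] E3 :=
  ContinuousLinearMap.id ℝ E3 - (innerSL ℝ e).smulRight e

lemma projOrth_apply (e x : E3) : projOrth e x = x - ⟪x, e⟫_ℝ • e := by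
  simp [projOrth, real_inner_comm]

lemma hasFDerivAt_projOrth_sub (e c a : E3) :
    HasFDerivAt (fun x => projOrth e (x - c)) (projOrth e) a := by
  have h := ((projOrth e).hasFDerivAt (x := a - c)).comp a ((hasFDerivAt_id a).sub_const c)
  rwa [ContinuousLinearMap.comp_id] at h

/-- The function `d² - ‖projOrth e (x - c)‖²` is nonnegative on the cylinder, and squaring makes it
differentiable everywhere. -/
lemma normal_circularCylinder (he : ‖e‖ = 1) (hd : 0 < d)
    (hν : IsSmoothWithInwardNormal (circularCylinder c e d) ν)
    (ha : a ∈ frontier (circularCylinder c e d)) : ν a = -(d⁻¹ • projOrth e (a - c)) := by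
  have hset : circularCylinder c e d = {x | ‖projOrth e (x - c)‖ ≤ d} := by
    simp only [circularCylinder, projOrth_apply]
  have had : ‖projOrth e (a - c)‖ = d := by
    rw [hset] at ha
    have hc : Continuous fun x : E3 => ‖projOrth e (x - c)‖ :=
      continuous_iff_continuousAt.2 fun x => (hasFDerivAt_projOrth_sub e c x).continuousAt.norm
    exact frontier_le_subset_eq hc continuous_const ha
  set p := projOrth e (a - c) with hp
  have hpe : ⟪p, e⟫_ℝ = 0 := by
    rw [hp, projOrth_apply, inner_sub_left, real_inner_smul_left, real_inner_self_eq_norm_sq, he]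
    ring
  have hG : HasGradientAt (fun x => d ^ 2 - ‖projOrth e (x - c)‖ ^ 2) (-((2 : ℝ) • p)) a := by
    rw [hasGradientAt_iff_hasFDerivAt]
    have h1 := hasFDerivAt_projOrth_sub e c a
    refine (h1.norm_sq.const_sub (d ^ 2)).congr_fderiv ?_
    ext v
    simp only [neg_apply, smul_apply,
      ContinuousLinearMap.comp_apply, innerSL_apply_apply, projOrth_apply e v, ← hp,
      InnerProductSpace.toDual_apply_apply, inner_neg_left, real_inner_smul_left, inner_sub_right,
      real_inner_smul_right, hpe, nsmul_eq_mul]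
    simp
  have hp0 : p ≠ 0 := norm_ne_zero_iff.1 (by rw [had]; exact hd.ne')
  rw [hν.eq_of_nonneg_on ha hG (by simpa using hp0) (by simp [← hp, had]) ?_]
  · rw [norm_neg, norm_smul, had, smul_neg, smul_smul]
    congr 2
    rw [Real.norm_ofNat]
    field_simp
  · refine Eventually.of_forall fun x hx => ?_
    rw [hset] at hx
    have : ‖projOrth e (x - c)‖ ^ 2 ≤ d ^ 2 := pow_le_pow_left₀ (norm_nonneg _) hx 2
    linarith

/-- The normal extends to an affine field with derivative `-d⁻¹ • projOrth e`, and the projection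
fixes `τ`. -/
lemma curvature_circularCylinder (he : ‖e‖ = 1) (hd : 0 < d)
    (hν : IsSmoothWithInwardNormal (circularCylinder c e d) ν)
    (ha : a ∈ frontier (circularCylinder c e d)) (hne : ⟪ν a, e⟫_ℝ = 0) :
    curvature (frontier (circularCylinder c e d)) ν e a = 1 / d := by
  have h1 : HasFDerivAt (fun x => -(d⁻¹ • projOrth e (x - c))) (-(d⁻¹ • projOrth e)) a :=
    ((hasFDerivAt_projOrth_sub e c a).const_smul d⁻¹).neg
  have h2 := hν.shapeOperator_eq_neg_of_hasFDerivAt (v := tau ν e a) ha (inner_cross_self _ _) h1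
    (Eventually.of_forall fun x hx => normal_circularCylinder he hd hν hx)
  have h3 : projOrth e (tau ν e a) = tau ν e a := by
    rw [projOrth_apply, real_inner_comm, tau, inner_self_cross]; simp
  have h4 : ‖tau ν e a‖ = 1 := norm_cross_eq_one (hν.norm_eq_one ha) he hne
  rw [curvature, normalCurvature, h2]
  simp [h3, real_inner_smul_left, h4]

end CircularCylinder

/-! ### General consequences of the constrained Newton equation. -/

section Dynamics

open scoped ContDiff

variable {V : Type*} [NormedAddCommGroup V] [InnerProductSpace ℝ V] [CompleteSpace V]

lemma IsRotation.comp_adjoint [FiniteDimensional ℝ V] {A : V →L[ℝ] V} (hA : IsRotation A) :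
    A ∘L ContinuousLinearMap.adjoint A = ContinuousLinearMap.id ℝ V := by
  have h : (ContinuousLinearMap.adjoint A : V →ₗ[ℝ] V) * (A : V →ₗ[ℝ] V) = 1 :=
    congrArg (fun T : V →L[ℝ] V => (T : V →ₗ[ℝ] V)) hA.1
  have h' := mul_eq_one_comm.1 h
  ext x
  exact congr($h' x)

lemma kinetic_sub_left (m r γ : ℝ) (ξ η ζ : Amb V) :
    kinetic m r γ (ξ - η) ζ = kinetic m r γ ξ ζ - kinetic m r γ η ζ := by
  have h : ((ξ.1 - η.1) ∘L ContinuousLinearMap.adjoint ζ.1 : V →L[ℝ] V) =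
      ξ.1 ∘L ContinuousLinearMap.adjoint ζ.1 - η.1 ∘L ContinuousLinearMap.adjoint ζ.1 := by
    ext x; simp
  simp only [kinetic, Prod.fst_sub, Prod.snd_sub, h, inner_sub_left,
    ContinuousLinearMap.toLinearMap_sub, map_sub]
  ring

namespace ConstrainedNewton

variable {m r γ : ℝ} {S : Set V} {ν : V → V} {f : Amb V → Amb V} {I : Set ℝ} {q : ℝ → Amb V}
  {t : ℝ}

lemma hasDerivAt (hq : ConstrainedNewton m r γ S ν f I q) (hI : IsOpen I) (ht : t ∈ I) :
    HasDerivAt q (deriv q t) t :=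
  ((hq.1.contDiffAt (hI.mem_nhds ht)).differentiableAt (by simp)).hasDerivAt

lemma contDiffOn_deriv (hq : ConstrainedNewton m r γ S ν f I q) (hI : IsOpen I) :
    ContDiffOn ℝ ∞ (deriv q) I :=
  hq.1.deriv_of_isOpen hI (by simp)

lemma hasDerivAt_deriv (hq : ConstrainedNewton m r γ S ν f I q) (hI : IsOpen I) (ht : t ∈ I) :
    HasDerivAt (deriv q) (deriv (deriv q) t) t :=
  (((hq.contDiffOn_deriv hI).contDiffAt (hI.mem_nhds ht)).differentiableAt (by simp)).hasDerivAt

lemma hasDerivAt_position (hq : ConstrainedNewton m r γ S ν f I q) (hI : IsOpen I) (ht : t ∈ I) :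
    HasDerivAt (fun s => (q s).2) (vel q t) t :=
  (ContinuousLinearMap.snd ℝ (V →L[ℝ] V) V).hasFDerivAt.comp_hasDerivAt t (hq.hasDerivAt hI ht)

lemma hasDerivAt_vel (hq : ConstrainedNewton m r γ S ν f I q) (hI : IsOpen I) (ht : t ∈ I) :
    HasDerivAt (vel q) (deriv (deriv q) t).2 t :=
  (ContinuousLinearMap.snd ℝ (V →L[ℝ] V) V).hasFDerivAt.comp_hasDerivAt t
    (hq.hasDerivAt_deriv hI ht)

lemma hasDerivAt_angularMap (hq : ConstrainedNewton m r γ S ν f I q) (hI : IsOpen I)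
    (ht : t ∈ I) :
    HasDerivAt (angularMap q) ((deriv (deriv q) t).1 ∘L ContinuousLinearMap.adjoint (q t).1
      + (deriv q t).1 ∘L ContinuousLinearMap.adjoint (deriv q t).1) t := by
  have h1 := (ContinuousLinearMap.fst ℝ (V →L[ℝ] V) V).hasFDerivAt.comp_hasDerivAt t
    (hq.hasDerivAt hI ht)
  have h2 := (ContinuousLinearMap.fst ℝ (V →L[ℝ] V) V).hasFDerivAt.comp_hasDerivAt t
    (hq.hasDerivAt_deriv hI ht)
  exact h2.clm_comp h1.star

lemma deriv_fst (hq : ConstrainedNewton m r γ S ν f I q) (ht : t ∈ I) :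
    (deriv q t).1 = angularMap q t ∘L (q t).1 := by
  ext x
  have h := congr($((hq.2 t ht).1.1) x)
  simp only [ContinuousLinearMap.comp_apply, ContinuousLinearMap.id_apply] at h
  simp [angularMap, h]

/-- The skew map provided by `noSlip` must be the angular map, because `A` is invertible. -/
lemma vel_eq [FiniteDimensional ℝ V] (hq : ConstrainedNewton m r γ S ν f I q) (ht : t ∈ I) :
    vel q t = r • angularMap q t (ν (q t).2) := by
  obtain ⟨hA, -, ⟨-, U, -, hU1, hU2⟩, -⟩ := hq.2 t ht
  have h : angularMap q t = U := by
    rw [angularMap, hU1, ContinuousLinearMap.comp_assoc, hA.comp_adjoint,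
      ContinuousLinearMap.comp_id]
  rw [h]; exact hU2

/-- The constrained Newton equation tested with a vector of the no-slip space. -/
lemma kinetic_eq_zero (hq : ConstrainedNewton m r γ S ν f I q) (ht : t ∈ I) {η : Amb V}
    (hη : η ∈ noSlip r ν (q t)) :
    kinetic m r γ (deriv (deriv q) t - m⁻¹ • f (q t)) η = 0 := by
  obtain ⟨-, -, -, N, hN, -, hZ⟩ := hq.2 t ht
  have h1 := hZ η hη.1
  -- The non-tangential part of the acceleration pairs to zero with every tangent vector, and `N`
  -- with every no-slip vector.
  rw [← sub_sub, kinetic_sub_left, hN.2 η hη, sub_zero] at h1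
  exact h1

end ConstrainedNewton

end Dynamics

/-! ### The vector equation of motion of the ball. -/

section Rolling

variable {m r γ g : ℝ} {S : Set E3} {ν : E3 → E3} {e : E3} {I : Set ℝ} {q : ℝ → Amb E3}
  {ω : ℝ → E3} {t : ℝ}

lemma crossLeft_comp_mem_noSlip (r : ℝ) (ν : E3 → E3) (p : Amb E3) (η : E3) :
    ((crossLeft η ∘L p.1, r • cross η (ν p.2)) : Amb E3) ∈ noSlip r ν p := by
  refine ⟨⟨⟨_, isSkew_crossLeft η, rfl⟩, ?_⟩, _, isSkew_crossLeft η, rfl, rfl⟩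
  rw [real_inner_smul_left, real_inner_comm, inner_self_cross, mul_zero]

/-- The vector form of the equation of motion. -/
lemma exists_angular_acceleration (hm : 0 < m) (hr : 0 < r) (hI : IsOpen I)
    (hq : ConstrainedNewton m r γ S ν (gravity m g e) I q)
    (hω : ∀ t ∈ I, ∀ w : E3, angularMap q t w = cross (ω t) w) (ht : t ∈ I) :
    ∃ ω' u' : E3, HasDerivAt ω ω' t ∧ HasDerivAt (vel q) u' t ∧
      (r * γ ^ 2) • ω' + cross (ν (q t).2) (u' + g • e) = 0 := by
  have hU := hq.hasDerivAt_angularMap hI ht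
  set X := (deriv (deriv q) t).1 ∘L ContinuousLinearMap.adjoint (q t).1 with hX
  set U' := X + (deriv q t).1 ∘L ContinuousLinearMap.adjoint (deriv q t).1 with hU'
  have hω' : HasDerivAt ω (axialCLM U') t := by
    refine (axialCLM.hasFDerivAt.comp_hasDerivAt t hU).congr_of_eventuallyEq ?_
    filter_upwards [hI.mem_nhds ht] with s hs
    exact (axial_eq (hω s hs)).symm
  set ω' := axialCLM U'
  have hU'w : ∀ w, U' w = cross ω' w := by
    intro w
    have h1 : HasDerivAt (fun s => angularMap q s w) (U' w) t := by
      simpa using hU.clm_apply (hasDerivAt_const t w)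
    have h2 : HasDerivAt (fun s => cross (ω s) w) (cross ω' w) t :=
      (crossRight w).hasFDerivAt.comp_hasDerivAt t hω'
    refine h1.unique (h2.congr_of_eventuallyEq ?_)
    filter_upwards [hI.mem_nhds ht] with s hs using hω s hs w
  have hUcross : angularMap q t = crossLeft (ω t) := by
    ext1 w; exact hω t ht w
  -- With `U = Ȧ Aᵀ` skew, `Ȧ Ȧᵀ = U Uᵀ = -U²`, so `Ä Aᵀ = U' + U²`.
  have hX' : ∀ w, X w = cross ω' w + cross (ω t) (cross (ω t) w) := by
    intro w
    have h1 : ((deriv q t).1 ∘L ContinuousLinearMap.adjoint (deriv q t).1 : E3 →L[ℝ] E3) w =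
        -cross (ω t) (cross (ω t) w) := by
      rw [hq.deriv_fst ht, ContinuousLinearMap.adjoint_comp, hUcross,
        show ContinuousLinearMap.adjoint (crossLeft (ω t)) = -crossLeft (ω t) from
          isSkew_crossLeft _]
      have h2 := congr($((hq.2 t ht).1.comp_adjoint) (-cross (ω t) w))
      simp only [ContinuousLinearMap.comp_apply, ContinuousLinearMap.id_apply] at h2
      simp only [ContinuousLinearMap.comp_apply, neg_apply, crossLeft_apply, h2]
      rw [← crossLeft_apply (ω t) (-_), map_neg, crossLeft_apply]
    have h3 := hU'w w
    rw [hU', add_apply, h1] at h3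
    rw [← h3]; abel
  refine ⟨ω', _, hω', hq.hasDerivAt_vel hI ht, ?_⟩
  set u' := (deriv (deriv q) t).2 with hu'
  rw [← inner_self_eq_zero (𝕜 := ℝ)]
  -- The vector to be shown zero serves as its own test vector: the equation then says `m r ⟪η, η⟫ =
  -- 0`.
  generalize hη : (r * γ ^ 2) • ω' + cross (ν (q t).2) (u' + g • e) = η
  have hk := hq.kinetic_eq_zero ht (crossLeft_comp_mem_noSlip r ν (q t) η)
  have hforce : m⁻¹ • gravity m g e (q t) = (0, -(g • e)) := by
    have : m⁻¹ * (m * g) = g := by field_simp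
    simp [gravity, smul_smul, this]
  -- The symmetric square of `ω ×` is trace-orthogonal to the skew map `η ×`; only `ω'` contributes.
  have htr : LinearMap.trace ℝ E3
      (((deriv (deriv q) t).1 ∘L ContinuousLinearMap.adjoint (crossLeft η ∘L (q t).1) :
        E3 →L[ℝ] E3) : E3 →ₗ[ℝ] E3) = 2 * ⟪ω', η⟫_ℝ := by
    rw [ContinuousLinearMap.adjoint_comp, ← ContinuousLinearMap.comp_assoc, ← hX,
      show ContinuousLinearMap.adjoint (crossLeft η) = -crossLeft η from isSkew_crossLeft _,
      trace_coord]
    simp only [ContinuousLinearMap.comp_apply, neg_apply, crossLeft_apply, hX',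
      PiLp.neg_apply, PiLp.add_apply, cross_zero_coord, cross_one_coord, cross_two_coord,
      inner_coord, PiLp.single_apply]
    simp
    ring
  rw [hforce, kinetic] at hk
  simp only [Prod.fst_sub, Prod.snd_sub, sub_zero, sub_neg_eq_add, htr, ← hu'] at hk
  rw [real_inner_smul_right, inner_cross_perm] at hk
  have h1 : ⟪η, η⟫_ℝ = r * γ ^ 2 * ⟪ω', η⟫_ℝ + ⟪cross (ν (q t).2) (u' + g • e), η⟫_ℝ := by
    conv_lhs => rw [← hη, inner_add_left, real_inner_smul_left, hη]
  have h2 : m * r * ⟪η, η⟫_ℝ = 0 := by rw [h1, ← hk]; ring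
  simpa [hm.ne', hr.ne'] using h2

end Rolling

/-! ### The harmonic oscillator. -/

section Oscillator

lemma eqOn_const_of_hasDerivAt_zero {I : Set ℝ} (hIo : IsOpen I) (hIc : I.OrdConnected)
    {f : ℝ → ℝ} (hf : ∀ t ∈ I, HasDerivAt f 0 t) {s t : ℝ} (hs : s ∈ I) (ht : t ∈ I) :
    f s = f t :=
  hIo.is_const_of_deriv_eq_zero hIc.isPreconnected
    (fun x hx => (hf x hx).differentiableAt.differentiableWithinAt)
    (fun x hx => (hf x hx).deriv) hs ht

/-- The solutions of `h'' + c₀ h + c₁ = 0` for `c₀ > 0`. -/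
lemma exists_harmonic {I : Set ℝ} (hIo : IsOpen I) (hIc : I.OrdConnected) (h0 : (0 : ℝ) ∈ I)
    {h h' h'' : ℝ → ℝ} {c₀ c₁ : ℝ} (hc : 0 < c₀) (hd : ∀ t ∈ I, HasDerivAt h (h' t) t)
    (hd' : ∀ t ∈ I, HasDerivAt h' (h'' t) t) (heq : ∀ t ∈ I, h'' t + c₀ * h t + c₁ = 0) :
    ∃ C₁ C₂ : ℝ, ∀ t ∈ I,
      h t = -(c₁ / c₀) + C₁ * Real.cos (√c₀ * t) + C₂ * Real.sin (√c₀ * t) := by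
  set k := √c₀ with hk
  have hk0 : k ≠ 0 := (Real.sqrt_pos.2 hc).ne'
  have hkc : c₀ = k ^ 2 := (Real.sq_sqrt hc.le).symm
  -- In the phase plane the point `(h + c₁ / c₀, h' / k)` rotates at angular speed `k`. `F` and `G`
  -- are its coordinates with the rotation undone, so they are constant, and their values at `0` are
  -- the amplitudes.
  let F := fun t => (h t + c₁ / c₀) * Real.cos (k * t) - h' t / k * Real.sin (k * t)
  let G := fun t => (h t + c₁ / c₀) * Real.sin (k * t) + h' t / k * Real.cos (k * t)
  have hkt : ∀ t : ℝ, HasDerivAt (fun t => k * t) k t := fun t => by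
    simpa using (hasDerivAt_id t).const_mul k
  have h2 : ∀ t ∈ I, h'' t = -(k ^ 2) * (h t + c₁ / c₀) := by
    intro t ht
    have := heq t ht
    rw [hkc] at this ⊢
    field_simp
    linarith
  have hF : ∀ t ∈ I, HasDerivAt F 0 t := by
    intro t ht
    refine HasDerivAt.congr_deriv ((((hd t ht).add_const (c₁ / c₀)).mul (hkt t).cos).sub
      (((hd' t ht).div_const k).mul (hkt t).sin)) ?_
    rw [h2 t ht]
    field_simp
    ring
  have hG : ∀ t ∈ I, HasDerivAt G 0 t := by
    intro t ht
    refine HasDerivAt.congr_deriv ((((hd t ht).add_const (c₁ / c₀)).mul (hkt t).sin).add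
      (((hd' t ht).div_const k).mul (hkt t).cos)) ?_
    rw [h2 t ht]
    field_simp
    ring
  refine ⟨F 0, G 0, fun t ht => ?_⟩
  rw [eqOn_const_of_hasDerivAt_zero hIo hIc hF h0 ht,
    eqOn_const_of_hasDerivAt_zero hIo hIc hG h0 ht]
  simp only [F, G]
  linear_combination -(h t + c₁ / c₀) * Real.sin_sq_add_cos_sq (k * t)

end Oscillator

/-! ### Component equations for rolling on a cylinder. -/

section RollingOnCylinder

lemma inner_cross_left_add_smul (n e u : E3) (g : ℝ) :
    ⟪cross n (u + g • e), e⟫_ℝ = -⟪u, cross n e⟫_ℝ := by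
  simp only [inner_coord, cross_zero_coord, cross_one_coord, cross_two_coord, PiLp.add_apply,
    PiLp.smul_apply, smul_eq_mul]
  ring

lemma inner_cross_cross (n x y : E3) :
    ⟪cross n x, cross n y⟫_ℝ = ⟪n, n⟫_ℝ * ⟪x, y⟫_ℝ - ⟪n, x⟫_ℝ * ⟪n, y⟫_ℝ := by
  simp only [inner_coord, cross_zero_coord, cross_one_coord, cross_two_coord]; ring

variable {m r γ g : ℝ} {B : Set E3} {ν : E3 → E3} {e : E3} {I : Set ℝ} {q : ℝ → Amb E3}
  {ω : ℝ → E3} {t : ℝ}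

lemma vel_eq_cross {S : Set E3} {f : Amb E3 → Amb E3} (hq : ConstrainedNewton m r γ S ν f I q)
    (hω : ∀ t ∈ I, ∀ w : E3, angularMap q t w = cross (ω t) w) (ht : t ∈ I) :
    vel q t = r • cross (ω t) (ν (q t).2) := by
  rw [hq.vel_eq ht, hω t ht]

lemma inner_vel_axis {S : Set E3} {f : Amb E3 → Amb E3} (hq : ConstrainedNewton m r γ S ν f I q)
    (hω : ∀ t ∈ I, ∀ w : E3, angularMap q t w = cross (ω t) w) (ht : t ∈ I) (e : E3) :
    ⟪vel q t, e⟫_ℝ = r * ⟪ω t, tau ν e (q t).2⟫_ℝ := by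
  rw [vel_eq_cross hq hω ht, real_inner_smul_left, real_inner_comm, inner_cross_perm, tau,
    inner_cross_perm, real_inner_comm, inner_cross_perm]

lemma inner_vel_tau (hB : IsSolidCylinder B e) (hν : IsSmoothWithInwardNormal B ν)
    {f : Amb E3 → Amb E3} (hq : ConstrainedNewton m r γ (frontier B) ν f I q)
    (hω : ∀ t ∈ I, ∀ w : E3, angularMap q t w = cross (ω t) w) (ht : t ∈ I) :
    ⟪vel q t, tau ν e (q t).2⟫_ℝ = -(r * ⟪ω t, e⟫_ℝ) := by
  have ha := (hq.2 t ht).2.1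
  rw [vel_eq_cross hq hω ht, real_inner_smul_left, real_inner_comm, inner_cross_perm,
    real_inner_comm, tau, cross_cross, hB.inner_normal_axis hν ha, real_inner_self_eq_norm_sq,
    hν.norm_eq_one ha, zero_smul, zero_sub, inner_neg_right, one_pow, one_smul]
  ring

/-- The derivatives of the normal and of `τ` along the path. -/
lemma hasDerivAt_normal (hB : IsSolidCylinder B e) (hν : IsSmoothWithInwardNormal B ν)
    (hI : IsOpen I) {f : Amb E3 → Amb E3} (hq : ConstrainedNewton m r γ (frontier B) ν f I q)
    (hω : ∀ t ∈ I, ∀ w : E3, angularMap q t w = cross (ω t) w) (ht : t ∈ I) :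
    HasDerivAt (fun s => ν (q s).2)
      ((r * curvature (frontier B) ν e (q t).2 * ⟪ω t, e⟫_ℝ) • tau ν e (q t).2) t := by
  have ha := (hq.2 t ht).2.1
  have hv : ⟪vel q t, ν (q t).2⟫_ℝ = 0 := (hq.2 t ht).2.2.1.1.2
  have h := hν.hasDerivAt_comp (hq.hasDerivAt_position hI ht)
    (by filter_upwards [hI.mem_nhds ht] with s hs using (hq.2 s hs).2.1)
  refine h.congr_deriv ?_
  rw [shapeOperator_tangent hB hν ha hv, inner_vel_tau hB hν hq hω ht, ← neg_smul]
  congr 1; ring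

lemma hasDerivAt_tau (hB : IsSolidCylinder B e) (hν : IsSmoothWithInwardNormal B ν)
    (hI : IsOpen I) {f : Amb E3 → Amb E3} (hq : ConstrainedNewton m r γ (frontier B) ν f I q)
    (hω : ∀ t ∈ I, ∀ w : E3, angularMap q t w = cross (ω t) w) (ht : t ∈ I) :
    HasDerivAt (fun s => tau ν e (q s).2)
      (-((r * curvature (frontier B) ν e (q t).2 * ⟪ω t, e⟫_ℝ) • ν (q t).2)) t := by
  have ha := (hq.2 t ht).2.1
  have h := (crossRight e).hasFDerivAt.comp_hasDerivAt t (hasDerivAt_normal hB hν hI hq hω ht)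
  refine h.congr_deriv ?_
  rw [map_smul, crossRight_apply, tau, cross_anticomm, cross_cross,
    real_inner_comm (ν (q t).2) e, real_inner_self_eq_norm_sq, hB.1, hB.inner_normal_axis hν ha]
  simp

/-- The equations of motion of the components of the angular and the linear velocity. -/
lemma hasDerivAt_rolling (hm : 0 < m) (hr : 0 < r) (hγ : 0 < γ) (hB : IsSolidCylinder B e)
    (hν : IsSmoothWithInwardNormal B ν) (hI : IsOpen I)
    (hq : ConstrainedNewton m r γ (frontier B) ν (gravity m g e) I q)
    (hω : ∀ t ∈ I, ∀ w : E3, angularMap q t w = cross (ω t) w) (ht : t ∈ I) :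
    HasDerivAt (fun s => ⟪ω s, e⟫_ℝ) 0 t ∧
    HasDerivAt (fun s => ⟪ω s, ν (q s).2⟫_ℝ)
      (curvature (frontier B) ν e (q t).2 * ⟪ω t, e⟫_ℝ * ⟪vel q t, e⟫_ℝ) t ∧
    HasDerivAt (fun s => ⟪vel q s, e⟫_ℝ)
      (-(γ ^ 2 / (1 + γ ^ 2) * r ^ 2 * curvature (frontier B) ν e (q t).2
            * ⟪ω t, e⟫_ℝ * ⟪ω t, ν (q t).2⟫_ℝ) - g / (1 + γ ^ 2)) t := by
  obtain ⟨ω', u', hω', hu', heq⟩ := exists_angular_acceleration hm hr hI hq hω ht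
  have ha := (hq.2 t ht).2.1
  have hIt := hI.mem_nhds ht
  have hN := hasDerivAt_normal hB hν hI hq hω ht
  have hT := hasDerivAt_tau hB hν hI hq hω ht
  have huN : ⟪vel q t, ν (q t).2⟫_ℝ = 0 := (hq.2 t ht).2.2.1.1.2
  have hNe := hB.inner_normal_axis hν ha
  have hNN : ⟪ν (q t).2, ν (q t).2⟫_ℝ = 1 := by
    rw [real_inner_self_eq_norm_sq, hν.norm_eq_one ha]; norm_num
  have hωe : HasDerivAt (fun s => ⟪ω s, e⟫_ℝ) ⟪ω', e⟫_ℝ t := by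
    simpa using hω'.inner ℝ (hasDerivAt_const t e)
  have hue : HasDerivAt (fun s => ⟪vel q s, e⟫_ℝ) ⟪u', e⟫_ℝ t := by
    simpa using hu'.inner ℝ (hasDerivAt_const t e)
  set lam := curvature (frontier B) ν e (q t).2 with hlam
  set N := ν (q t).2 with hNdef
  set T := tau ν e (q t).2 with hTdef
  have hTcross : T = cross N e := rfl
  -- `eN`, `ee` and `eT` are the components of the vector equation along `ν`, `e` and `τ`.
  have eN : ⟪ω', N⟫_ℝ = 0 := by
    have h := congrArg (fun x => ⟪x, N⟫_ℝ) heq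
    simp only [inner_add_left, real_inner_smul_left, inner_zero_left] at h
    rw [real_inner_comm N (cross _ _), inner_cross_self, add_zero] at h
    exact (mul_eq_zero.1 h).resolve_left (by positivity)
  have ee : r * γ ^ 2 * ⟪ω', e⟫_ℝ - ⟪u', T⟫_ℝ = 0 := by
    have h := congrArg (fun x => ⟪x, e⟫_ℝ) heq
    simp only [inner_add_left, real_inner_smul_left, inner_zero_left,
      inner_cross_left_add_smul] at h
    exact h
  have eT : r * γ ^ 2 * ⟪ω', T⟫_ℝ + ⟪u', e⟫_ℝ + g = 0 := by
    have h := congrArg (fun x => ⟪x, T⟫_ℝ) heq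
    simp only [inner_add_left, real_inner_smul_left, inner_zero_left] at h
    rw [hTcross, inner_cross_cross, hNN, hNe, inner_add_left, real_inner_smul_left,
      real_inner_self_eq_norm_sq, hB.1, ← hTcross] at h
    linear_combination h
  -- Derivative of `u · τ = -r ω · e`; the term `u · τ'` vanishes because `τ'` is normal and `u`
  -- tangent.
  have hyd : -(r * ⟪ω', e⟫_ℝ) = ⟪u', T⟫_ℝ := by
    have h1 := hu'.inner ℝ hT
    have h2 : HasDerivAt (fun s => ⟪vel q s, tau ν e (q s).2⟫_ℝ) (-(r * ⟪ω', e⟫_ℝ)) t := by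
      refine (hωe.const_mul r).neg.congr_of_eventuallyEq ?_
      filter_upwards [hIt] with s hs using inner_vel_tau hB hν hq hω hs
    have h3 := h2.unique h1
    rw [inner_neg_right, real_inner_smul_right, huN] at h3
    rw [h3]; simp [hTdef]
  -- Derivative of `u · e = r ω · τ`; here `τ'` produces the coupling to `ω · ν`.
  have hxd : ⟪u', e⟫_ℝ = r * (⟪ω', T⟫_ℝ - r * lam * ⟪ω t, e⟫_ℝ * ⟪ω t, N⟫_ℝ) := by
    have h1 := (hω'.inner ℝ hT).const_mul r
    have h2 : HasDerivAt (fun s => r * ⟪ω s, tau ν e (q s).2⟫_ℝ) ⟪u', e⟫_ℝ t := by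
      refine hue.congr_of_eventuallyEq ?_
      filter_upwards [hIt] with s hs using (inner_vel_axis hq hω hs e).symm
    have h3 := h2.unique h1
    rw [inner_neg_right, real_inner_smul_right] at h3
    rw [h3]; ring
  have hγ1 : 0 < 1 + γ ^ 2 := by positivity
  refine ⟨hωe.congr_deriv ?_, (hω'.inner ℝ hN).congr_deriv ?_, hue.congr_deriv ?_⟩
  -- The two expressions for `u' · τ`, namely `r γ² ω' · e` and `-r ω' · e`, have opposite signs,
  -- which forces `ω' · e = 0`.
  · have : r * (1 + γ ^ 2) * ⟪ω', e⟫_ℝ = 0 := by linear_combination ee - hyd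
    simpa [hr.ne', hγ1.ne'] using this
  · rw [real_inner_smul_right, inner_vel_axis hq hω ht e]
    linear_combination eN
  · field_simp
    linear_combination eT + γ ^ 2 * hxd

end RollingOnCylinder

end RollingBall

end

theorem mainTheorem7
    (m r γ g : ℝ) (hm : 0 < m) (hr : 0 < r) (hγ : 0 < γ)
    (B : Set E3) (e : E3) (ν : E3 → E3)
    (hB : IsSolidCylinder B e) (hν : IsSmoothWithInwardNormal B ν)
    (I : Set ℝ) (hIo : IsOpen I) (hIc : I.OrdConnected) (h0 : (0 : ℝ) ∈ I)
    (q : ℝ → Amb E3)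
    (hq : ConstrainedNewton m r γ (frontier B) ν (gravity m g e) I q)
    (ω : ℝ → E3) (hω : ∀ t ∈ I, ∀ w : E3, angularMap q t w = cross (ω t) w) :
    -- `curvature` is the principal curvature in the direction of `τ`, the other one is zero
    (∀ a ∈ frontier B,
      shapeOperator (frontier B) ν a (tau ν e a) = curvature (frontier B) ν e a • tau ν e a ∧
      shapeOperator (frontier B) ν a e = 0) ∧
    -- `ω · e` is a constant of motion
    (∀ t ∈ I, ⟪ω t, e⟫_ℝ = ⟪ω 0, e⟫_ℝ) ∧
    -- the equation of `u · e`
    (∀ t ∈ I, DifferentiableAt ℝ (fun s => ⟪vel q s, e⟫_ℝ) t ∧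
      deriv (fun s => ⟪vel q s, e⟫_ℝ) t
        + γ ^ 2 / (1 + γ ^ 2) * r ^ 2 * curvature (frontier B) ν e (q t).2
            * ⟪ω t, e⟫_ℝ * ⟪ω t, ν (q t).2⟫_ℝ
        + g / (1 + γ ^ 2) = 0) ∧
    -- the equation of `ω · ν`
    (∀ t ∈ I, HasDerivAt (fun s => ⟪ω s, ν (q s).2⟫_ℝ)
      (curvature (frontier B) ν e (q t).2 * ⟪ω t, e⟫_ℝ * ⟪vel q t, e⟫_ℝ) t) ∧
    -- `u · e` is the derivative of the height
    (∀ t ∈ I, HasDerivAt (height e q) ⟪vel q t, e⟫_ℝ t) ∧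
    -- the second order integro-differential equation of the height
    (∀ t ∈ I,
      IntervalIntegrable
        (fun s => curvature (frontier B) ν e (q s).2 * deriv (height e q) s) volume 0 t ∧
      DifferentiableAt ℝ (deriv (height e q)) t ∧
      deriv (deriv (height e q)) t
        + γ ^ 2 / (1 + γ ^ 2) * r ^ 2 * curvature (frontier B) ν e (q t).2 * ⟪ω 0, e⟫_ℝ
            * (⟪ω 0, ν (q 0).2⟫_ℝ + ⟪ω 0, e⟫_ℝ *
                ∫ s in (0 : ℝ)..t,
                  curvature (frontier B) ν e (q s).2 * deriv (height e q) s)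
        + g / (1 + γ ^ 2) = 0) ∧
    -- circular cylinders: harmonic oscillation
    (∀ (R : ℝ) (c : E3), r < R → B = circularCylinder c e (R - r) →
      (∀ a ∈ frontier B, curvature (frontier B) ν e a = 1 / (R - r)) ∧
      ∀ c₀ c₁ : ℝ,
        c₀ = γ ^ 2 / (1 + γ ^ 2) * (r / (R - r)) ^ 2 * ⟪ω 0, e⟫_ℝ ^ 2 →
        c₁ = γ ^ 2 / (1 + γ ^ 2) * (r ^ 2 / (R - r)) * ⟪ω 0, e⟫_ℝ
              * (⟪ω 0, ν (q 0).2⟫_ℝ - 1 / (R - r) * ⟪ω 0, e⟫_ℝ * height e q 0)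
            + g / (1 + γ ^ 2) →
        (∀ t ∈ I, deriv (deriv (height e q)) t + c₀ * height e q t + c₁ = 0) ∧
        (⟪ω 0, e⟫_ℝ ≠ 0 → 0 < c₀ ∧ ∃ C₁ C₂ : ℝ, ∀ t ∈ I,
          height e q t = -(c₁ / c₀) + C₁ * Real.cos (√c₀ * t) + C₂ * Real.sin (√c₀ * t))) := by
  have hrot := fun t ht => hasDerivAt_rolling hm hr hγ hB hν hIo hq hω (t := t) ht
  have hωe : ∀ t ∈ I, ⟪ω t, e⟫_ℝ = ⟪ω 0, e⟫_ℝ := fun t ht =>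
    eqOn_const_of_hasDerivAt_zero hIo hIc (fun s hs => (hrot s hs).1) ht h0
  have hh : ∀ t ∈ I, HasDerivAt (height e q) ⟪vel q t, e⟫_ℝ t := fun t ht => by
    simpa using! (hq.hasDerivAt_position hIo ht).inner ℝ (hasDerivAt_const t e)
  have hdh : ∀ t ∈ I, deriv (height e q) =ᶠ[nhds t] fun s => ⟪vel q s, e⟫_ℝ := fun t ht => by
    filter_upwards [hIo.mem_nhds ht] with s hs using (hh s hs).deriv
  have hdd := fun t ht => (hrot t ht).2.2.congr_of_eventuallyEq (hdh t ht)
  have hcont : ContinuousOn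
      (fun s => curvature (frontier B) ν e (q s).2 * deriv (height e q) s) I := by
    refine ContinuousOn.mul ?_ fun t ht => (hdd t ht).continuousAt.continuousWithinAt
    exact (continuousOn_curvature hν).comp
      (fun t ht => (hq.hasDerivAt_position hIo ht).continuousAt.continuousWithinAt)
      fun t ht => (hq.2 t ht).2.1
  have hint : ∀ t ∈ I, IntervalIntegrable
      (fun s => curvature (frontier B) ν e (q s).2 * deriv (height e q) s) volume 0 t :=
    fun t ht => (hcont.mono (hIc.uIcc_subset h0 ht)).intervalIntegrable
  have hων : ∀ t ∈ I, ⟪ω t, ν (q t).2⟫_ℝ = ⟪ω 0, ν (q 0).2⟫_ℝ + ⟪ω 0, e⟫_ℝ *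
      ∫ s in (0 : ℝ)..t, curvature (frontier B) ν e (q s).2 * deriv (height e q) s := by
    intro t ht
    have h1 : ∀ s ∈ uIcc 0 t, HasDerivAt (fun s => ⟪ω s, ν (q s).2⟫_ℝ)
        (⟪ω 0, e⟫_ℝ * (curvature (frontier B) ν e (q s).2 * deriv (height e q) s)) s := by
      intro s hs
      have hsI := hIc.uIcc_subset h0 ht hs
      refine (hrot s hsI).2.1.congr_deriv ?_
      rw [(hh s hsI).deriv, hωe s hsI]
      ring
    have h2 := intervalIntegral.integral_eq_sub_of_hasDerivAt h1 ((hint t ht).const_mul _)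
    rw [intervalIntegral.integral_const_mul] at h2
    linarith
  refine ⟨fun a ha => ⟨shapeOperator_tau hB hν ha, hB.shapeOperator_axis hν ha⟩, hωe,
    fun t ht => ⟨(hrot t ht).2.2.differentiableAt, ?_⟩, fun t ht => (hrot t ht).2.1, hh,
    fun t ht => ⟨hint t ht, (hdd t ht).differentiableAt, ?_⟩, ?_⟩
  · rw [(hrot t ht).2.2.deriv]; ring
  · rw [(hdd t ht).deriv, ← hων t ht, hωe t ht]; ring
  intro R c hR hBc
  have hd : 0 < R - r := sub_pos.2 hR
  have hlam : ∀ a ∈ frontier B, curvature (frontier B) ν e a = 1 / (R - r) := by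
    intro a ha
    have hne := hB.inner_normal_axis hν ha
    subst hBc
    exact curvature_circularCylinder hB.1 hd hν ha hne
  refine ⟨hlam, fun c₀ c₁ hc₀ hc₁ => ?_⟩
  -- For constant `λ` the equation of `ω · ν` integrates to the conserved quantity `ω · ν - λ (ω ·
  -- e) h`, whose initial value appears in `c₁`.
  have hconst : ∀ t ∈ I, ⟪ω t, ν (q t).2⟫_ℝ - 1 / (R - r) * ⟪ω 0, e⟫_ℝ * height e q t =
      ⟪ω 0, ν (q 0).2⟫_ℝ - 1 / (R - r) * ⟪ω 0, e⟫_ℝ * height e q 0 := by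
    refine fun t ht => eqOn_const_of_hasDerivAt_zero hIo hIc (f := fun t =>
      ⟪ω t, ν (q t).2⟫_ℝ - 1 / (R - r) * ⟪ω 0, e⟫_ℝ * height e q t) (fun s hs => ?_) ht h0
    refine ((hrot s hs).2.1.sub ((hh s hs).const_mul _)).congr_deriv ?_
    rw [hlam _ (hq.2 s hs).2.1, hωe s hs]
    ring
  have hode : ∀ t ∈ I, deriv (deriv (height e q)) t + c₀ * height e q t + c₁ = 0 := by
    intro t ht
    rw [(hdd t ht).deriv, hc₁, ← hconst t ht, hc₀, hlam _ (hq.2 t ht).2.1, hωe t ht]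
    ring
  refine ⟨hode, fun hω0 => ?_⟩
  have hc : 0 < c₀ := by rw [hc₀]; positivity
  exact ⟨hc, exists_harmonic hIo hIc h0 hc (fun t ht => (hh t ht).differentiableAt.hasDerivAt)
    (fun t ht => (hdd t ht).differentiableAt.hasDerivAt) hode⟩
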